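/- There are absolute constants $0<C_1\le C_2$ and $C_3>0$ such that the following holds for every $s\in\mathbb N=\{1,2,\dots\}$, every probability space $(\Omega,\mu)$ (in particular, every compact $\Omega\subset\mathbb R^d$ with a Borel probability measure $\mu$) and every $N$. Let $X_N\subset L_{2s}(\Omega,\mu)$ be a real or complex linear subspace spanned by $N$ functions (so that its dimension is at most $N$). Its elements are functions, not equivalence classes; they need to be defined only outside a common set $E\subset\Omega$ with $\mu(E)=0$. Then for every integer $m\ge C_3N^s$ one has $X_N\in\mathcal M^w(m,2s,C_1,C_2)$, and the weights can be taken positive: there exist knots $\xi^1,\dots,\xi^m\in\Omega\setminus E$ (not necessarily distinct) and weights $\lambda_1,\dots,\lambda_m>0$ such that for all $f\in X_N$ $$ C_1\|f\|_{2s}^{2s}\le\sum_{\nu=1}^m\lambda_\nu|f(\xi^\nu)|^{2s}\le C_2\|f\|_{2s}^{2s},\qquad \|f\|_{2s}^{2s}=\int_\Omega|f|^{2s}\,d\mu . $$ Here $\mathcal M^w(m,q,C_1,C_2)$ is the class of subspaces for which such knots and some real weights exist, with exponent $q$ in place of $2s$. -/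

import Mathlib

open MeasureTheory

namespace SamplingDiscretization

/-- `X` is an `N`-dimensional (more precisely, of dimension at most `N`) linear space of functions
in `L_q(Ω, μ)`: it consists of `q`-integrable functions and is spanned by `N` of them. Its elements
are genuine functions, not equivalence classes. A space of functions that are defined only outside
a `μ`-null set `E` is represented by extending its elements to `E` in any linear way, for example
by zero. -/
def IsSubspaceLq {Ω : Type*} [MeasurableSpace Ω] (μ : Measure Ω) {𝕜 : Type*} [RCLike 𝕜]
    (q : ℝ) (N : ℕ) (X : Submodule 𝕜 (Ω → 𝕜)) : Prop :=
  (∀ f ∈ X, MemLp f (ENNReal.ofReal q) μ) ∧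
    ∃ u : Fin N → Ω → 𝕜, X = Submodule.span 𝕜 (Set.range u)

/-- The two-sided inequality
`C₁ ‖f‖_q^q ≤ ∑ ν, lam ν * |f (ξ ν)|^q ≤ C₂ ‖f‖_q^q` for all `f` in `X`. -/
def Discretizes {Ω : Type*} [MeasurableSpace Ω] (μ : Measure Ω) {𝕜 : Type*} [RCLike 𝕜]
    (X : Submodule 𝕜 (Ω → 𝕜)) {m : ℕ} (q C₁ C₂ : ℝ) (ξ : Fin m → Ω) (lam : Fin m → ℝ) : Prop :=
  ∀ f ∈ X,
    C₁ * lpNorm f (ENNReal.ofReal q) μ ^ q ≤ ∑ ν, lam ν * ‖f (ξ ν)‖ ^ q ∧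
    ∑ ν, lam ν * ‖f (ξ ν)‖ ^ q ≤ C₂ * lpNorm f (ENNReal.ofReal q) μ ^ q

/-- The weighted Marcinkiewicz property `X ∈ M^w(m, q, C₁, C₂)` for a space of functions that are
defined outside the exceptional set `E`: there are `m` knots outside `E` and `m` real weights
that discretize the `L_q` norm on `X`. -/
def WeightedMarcinkiewicz {Ω : Type*} [MeasurableSpace Ω] (μ : Measure Ω) {𝕜 : Type*} [RCLike 𝕜]
    (E : Set Ω) (X : Submodule 𝕜 (Ω → 𝕜)) (m : ℕ) (q C₁ C₂ : ℝ) : Prop :=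
  ∃ (ξ : Fin m → Ω) (lam : Fin m → ℝ), (∀ ν, ξ ν ∉ E) ∧ Discretizes μ X q C₁ C₂ ξ lam

/-- The property `X ∈ M^w(m, q, C₁, C₂)` with positive weights. -/
def PositiveWeightedMarcinkiewicz {Ω : Type*} [MeasurableSpace Ω] (μ : Measure Ω)
    {𝕜 : Type*} [RCLike 𝕜]
    (E : Set Ω) (X : Submodule 𝕜 (Ω → 𝕜)) (m : ℕ) (q C₁ C₂ : ℝ) : Prop :=
  ∃ (ξ : Fin m → Ω) (lam : Fin m → ℝ), (∀ ν, ξ ν ∉ E) ∧ (∀ ν, 0 < lam ν) ∧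
    Discretizes μ X q C₁ C₂ ξ lam

theorem PositiveWeightedMarcinkiewicz.weighted {Ω : Type*} [MeasurableSpace Ω] {μ : Measure Ω}
    {𝕜 : Type*} [RCLike 𝕜] {E : Set Ω} {X : Submodule 𝕜 (Ω → 𝕜)} {m : ℕ} {q C₁ C₂ : ℝ}
    (h : PositiveWeightedMarcinkiewicz μ E X m q C₁ C₂) :
    WeightedMarcinkiewicz μ E X m q C₁ C₂ := by
  obtain ⟨ξ, lam, hE, -, hd⟩ := h
  exact ⟨ξ, lam, hE, hd⟩

end SamplingDiscretization

/-! If `f` is a combination of `N` functions, then `f ^ s` is a combination of their `N ^ s`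
products of length `s`, which lie in L₂ by Hölder. Since `|f| ^ (2s) = |f ^ s| ^ 2`, it suffices to
discretize the L₂ norm on a space of dimension `n ≤ N ^ s` with any `m ≥ 4n` knots
(`exists_discretization_of_memLp_two`).

For L₂, take an orthonormal basis `φ` and run the Batson–Spielman–Srivastava argument with `μ` in
place of a finite sum. Rank-one terms `t φ(x) φ(x)*` are added one at a time, keeping the spectrum
between barriers that start at `-2n` and `6n` and move up by 1 and 4. The inverse traces of the
distances to the barriers stay at most 1/2 and 1/6. A good `x` exists because the wanted inequality
holds strictly on average over `μ` (`exists_point_barrier`). After `m ≥ 4n` steps the spectrum lies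
between `m - 2n ≥ m/2` and `4m + 6n ≤ 6m`; dividing the weights by `m` gives the constants 1/2 and
6. -/

namespace SamplingDiscretization

/-! ### Scalar barrier estimates and rank-one updates of diagonal matrices. -/

open Matrix
open scoped ComplexOrder

variable {𝕜 : Type*} [RCLike 𝕜] {n : Type*} [Fintype n]

theorem norm_sum_star_mul_sq_le (d : n → ℝ) (hd : ∀ i, 0 < d i) (v x : n → 𝕜) :
    ‖∑ i, star (v i) * x i‖ ^ 2 ≤ (∑ i, ‖v i‖ ^ 2 / d i) * ∑ i, d i * ‖x i‖ ^ 2 := by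
  have h1 : ‖∑ i, star (v i) * x i‖ ≤ ∑ i, ‖v i‖ * ‖x i‖ :=
    (norm_sum_le _ _).trans (by simp)
  refine (pow_le_pow_left₀ (norm_nonneg _) h1 2).trans ?_
  refine Finset.sum_sq_le_sum_mul_sum_of_sq_le_mul _ (fun i _ => ?_) (fun i _ => ?_) fun i _ => ?_
  · have := hd i; positivity
  · have := hd i; positivity
  · have := (hd i).ne'
    refine le_of_eq ?_
    field_simp

/-- The averaged lower barrier estimate. -/
theorem lower_barrier_average [Nonempty n] {α : n → ℝ} (hα : ∀ i, 0 < α i)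
    (h : ∑ i, (α i)⁻¹ ≤ 1 / 2) :
    (∀ i, 0 < α i - 1) ∧ 0 < ∑ i, (α i - 1)⁻¹ - ∑ i, (α i)⁻¹ ∧
    1 / 2 ≤ (∑ i, 1 / (α i - 1) ^ 2) / (∑ i, (α i - 1)⁻¹ - ∑ i, (α i)⁻¹) -
      ∑ i, 1 / (α i - 1) := by
  have h0 : ∀ i, 0 < α i - 1 := fun i => by
    have h1 : (α i)⁻¹ ≤ 1 / 2 :=
      (Finset.single_le_sum (fun j _ => (inv_pos.2 (hα j)).le) (Finset.mem_univ i)).trans h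
    have : 2 ≤ α i := by
      have := (inv_le_comm₀ (hα i) (by norm_num)).1 h1
      norm_num at this; exact this
    linarith
  have hD : ∑ i, (α i - 1)⁻¹ - ∑ i, (α i)⁻¹ = ∑ i, 1 / (α i * (α i - 1)) := by
    rw [← Finset.sum_sub_distrib]
    refine Finset.sum_congr rfl fun i _ => ?_
    have h1 := (h0 i).ne'
    have h2 := (hα i).ne'
    field_simp
    ring
  have hDpos : 0 < ∑ i, (α i - 1)⁻¹ - ∑ i, (α i)⁻¹ := by
    rw [hD]
    exact Finset.sum_pos (fun i _ => one_div_pos.2 (mul_pos (hα i) (h0 i))) Finset.univ_nonempty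
  refine ⟨h0, hDpos, ?_⟩
  have hS : ∑ i, 1 / (α i - 1) ^ 2 =
      ∑ i, 1 / (α i * (α i - 1)) + ∑ i, 1 / (α i * (α i - 1) ^ 2) := by
    rw [← Finset.sum_add_distrib]
    refine Finset.sum_congr rfl fun i _ => ?_
    have h1 := (h0 i).ne'
    have h2 := (hα i).ne'
    field_simp
    ring
  have hcs : (∑ i, 1 / (α i * (α i - 1))) ^ 2 ≤
      (∑ i, (α i)⁻¹) * ∑ i, 1 / (α i * (α i - 1) ^ 2) := by
    refine Finset.sum_sq_le_sum_mul_sum_of_sq_le_mul _ (fun i _ => ?_) (fun i _ => ?_) fun i _ => ?_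
    · exact (inv_pos.2 (hα i)).le
    · have := hα i; have := h0 i; positivity
    · have h1 := (h0 i).ne'
      have h2 := (hα i).ne'
      refine le_of_eq ?_
      field_simp
  have hnn : 0 ≤ ∑ i, 1 / (α i * (α i - 1) ^ 2) :=
    Finset.sum_nonneg fun i _ => by have := hα i; positivity
  simp only [one_div (α _ - 1)] at *
  set D := ∑ i, (α i - 1)⁻¹ - ∑ i, (α i)⁻¹ with hDdef
  -- By `hS` this amounts to `D ^ 2 ≤ ∑ 1 / (α (α - 1) ^ 2)`, which `hcs` gives with a factor 1/2 to
  -- spare. The `D` on the left offsets the growth of the potential, leaving `1 - ∑ α⁻¹ ≥ 1/2`.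
  have key : 1 + D ≤ (∑ i, 1 / (α i - 1) ^ 2) / D := by
    rw [le_div_iff₀ hDpos, hS, ← hD]
    rw [← hD] at hcs
    nlinarith
  linarith

/-- The averaged upper barrier estimate. -/
theorem upper_barrier_average [Nonempty n] {β : n → ℝ} (hβ : ∀ i, 0 < β i)
    (h : ∑ i, (β i)⁻¹ ≤ 1 / 6) :
    0 < ∑ i, (β i)⁻¹ - ∑ i, (β i + 4)⁻¹ ∧
    (∑ i, 1 / (β i + 4) ^ 2) / (∑ i, (β i)⁻¹ - ∑ i, (β i + 4)⁻¹) + ∑ i, 1 / (β i + 4) < 1 / 2 := by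
  have h0 : ∀ i, 0 < β i + 4 := fun i => by linarith [hβ i]
  have hD : ∑ i, (β i)⁻¹ - ∑ i, (β i + 4)⁻¹ = ∑ i, 4 / (β i * (β i + 4)) := by
    rw [← Finset.sum_sub_distrib]
    refine Finset.sum_congr rfl fun i _ => ?_
    have h1 := (h0 i).ne'
    have h2 := (hβ i).ne'
    field_simp
    ring
  have hDpos : 0 < ∑ i, (β i)⁻¹ - ∑ i, (β i + 4)⁻¹ := by
    rw [hD]
    exact Finset.sum_pos (fun i _ => div_pos (by norm_num) (mul_pos (hβ i) (h0 i)))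
      Finset.univ_nonempty
  refine ⟨hDpos, ?_⟩
  have hS : 4 * ∑ i, 1 / (β i + 4) ^ 2 ≤ ∑ i, 4 / (β i * (β i + 4)) := by
    rw [Finset.mul_sum]
    refine Finset.sum_le_sum fun i _ => ?_
    rw [mul_one_div]
    have := h0 i
    have := hβ i
    gcongr
    nlinarith
  simp only [one_div (β _ + 4)] at *
  -- The shift 4 makes the total at most 1/4 + 1/6 < 1/2, strictly below the lower average.
  have key : (∑ i, 1 / (β i + 4) ^ 2) / (∑ i, (β i)⁻¹ - ∑ i, (β i + 4)⁻¹) ≤ 1 / 4 := by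
    rw [div_le_iff₀ hDpos, hD]
    linarith
  linarith

variable [DecidableEq n]

theorem star_dotProduct_diagonal_add_smul_vecMulVec_mulVec (d : n → ℝ) (v x : n → 𝕜) (c : ℝ) :
    star x ⬝ᵥ ((diagonal (fun i => (d i : 𝕜)) + (c : 𝕜) • vecMulVec v (star v)) *ᵥ x) =
      ((∑ i, d i * ‖x i‖ ^ 2 + c * ‖∑ i, star (v i) * x i‖ ^ 2 : ℝ) : 𝕜) := by
  have h1 : star x ⬝ᵥ v = star (star v ⬝ᵥ x) := by rw [star_dotProduct]
  have h2 : ∑ i, star (v i) * x i = star v ⬝ᵥ x := rfl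
  rw [add_mulVec, dotProduct_add, smul_mulVec, vecMulVec_mulVec, dotProduct_smul,
    dotProduct_smul, h1, h2]
  push_cast
  congr 1
  · simp only [dotProduct, mulVec_diagonal, Pi.star_apply, RCLike.star_def]
    refine Finset.sum_congr rfl fun i _ => ?_
    rw [← RCLike.conj_mul]
    ring
  · rw [← RCLike.conj_mul]
    simp

theorem posDef_diagonal_add_smul_vecMulVec (d : n → ℝ) (hd : ∀ i, 0 < d i) (v : n → 𝕜) (c : ℝ)
    (h : 0 < 1 + c * ∑ i, ‖v i‖ ^ 2 / d i) :
    (diagonal (fun i => (d i : 𝕜)) + (c : 𝕜) • vecMulVec v (star v)).PosDef := by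
  refine PosDef.of_dotProduct_mulVec_pos ?_ fun x hx => ?_
  · refine IsHermitian.add (isHermitian_diagonal_of_self_adjoint _ ?_) ?_
    · ext i; simp
    · ext i j; simp [vecMulVec_apply, RCLike.real_smul_eq_coe_mul, mul_comm]
  · rw [star_dotProduct_diagonal_add_smul_vecMulVec_mulVec, RCLike.ofReal_pos]
    have hq : 0 < ∑ i, d i * ‖x i‖ ^ 2 := by
      obtain ⟨i, hi⟩ := Function.ne_iff.1 hx
      refine Finset.sum_pos' (fun j _ => ?_) ⟨i, Finset.mem_univ _, ?_⟩
      · have := hd j; positivity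
      · have := hd i
        have : 0 < ‖x i‖ := norm_pos_iff.2 hi
        positivity
    have hcs := norm_sum_star_mul_sq_le d hd v x
    rcases le_total 0 c with hc | hc
    · positivity
    -- For `c ≤ 0`, Cauchy–Schwarz bounds the form below by `1 + c τ` times its diagonal part, where
    -- `τ = ∑ ‖v i‖ ^ 2 / d i`.
    · nlinarith [mul_le_mul_of_nonpos_left hcs hc]

/-- Sherman–Morrison formula, checked by multiplying out. -/
theorem inv_diagonal_add_smul_vecMulVec (d : n → ℝ) (hd : ∀ i, 0 < d i) (v : n → 𝕜) (c : ℝ)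
    (h : 0 < 1 + c * ∑ i, ‖v i‖ ^ 2 / d i) :
    (diagonal (fun i => (d i : 𝕜)) + (c : 𝕜) • vecMulVec v (star v))⁻¹ =
      diagonal (fun i => ((d i)⁻¹ : 𝕜)) -
        ((c / (1 + c * ∑ i, ‖v i‖ ^ 2 / d i) : ℝ) : 𝕜) •
          vecMulVec (fun i => v i / d i) (star fun i => v i / (d i : 𝕜)) := by
  apply inv_eq_right_inv
  have hd' : ∀ i, (d i : 𝕜) ≠ 0 := fun i => RCLike.ofReal_ne_zero.2 (hd i).ne'
  set w : n → 𝕜 := fun i => v i / d i with hw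
  set τ := ∑ i, ‖v i‖ ^ 2 / d i with hτ
  set κ := c / (1 + c * τ) with hκ
  have h1 : diagonal (fun i => (d i : 𝕜)) * diagonal (fun i => ((d i)⁻¹ : 𝕜)) = 1 := by
    rw [diagonal_mul_diagonal, ← diagonal_one]
    congr 1; ext i; exact mul_inv_cancel₀ (hd' i)
  have h2 : diagonal (fun i => (d i : 𝕜)) * vecMulVec w (star w) = vecMulVec v (star w) := by
    ext i j
    simp only [diagonal_mul, vecMulVec_apply, hw]
    field_simp [hd' i]
  have h3 : vecMulVec v (star v) * diagonal (fun i => ((d i)⁻¹ : 𝕜)) = vecMulVec v (star w) := by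
    ext i j
    simp [mul_diagonal, vecMulVec_apply, hw, div_eq_mul_inv, mul_assoc]
  have h4 : vecMulVec v (star v) * vecMulVec w (star w) = (τ : 𝕜) • vecMulVec v (star w) := by
    have : star v ⬝ᵥ w = (τ : 𝕜) := by
      simp only [dotProduct, hτ, hw, Pi.star_apply, RCLike.star_def]
      push_cast
      refine Finset.sum_congr rfl fun i _ => ?_
      rw [← RCLike.conj_mul, mul_div_assoc]
    rw [vecMulVec_mul_vecMulVec, this, vecMulVec_smul]
  have hs : c - κ - c * κ * τ = 0 := by
    rw [hκ]; field_simp; ring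
  have hs' : (c : 𝕜) - κ - c * κ * τ = 0 := by exact_mod_cast congrArg (fun r : ℝ => (r : 𝕜)) hs
  rw [add_mul, mul_sub, mul_sub, Matrix.mul_smul, Matrix.smul_mul, Matrix.smul_mul,
    Matrix.mul_smul, h1, h2, h3, h4, smul_smul, smul_smul]
  have : (1 : Matrix n n 𝕜) - (κ : 𝕜) • vecMulVec v (star w) +
      ((c : 𝕜) • vecMulVec v (star w) - ((c : 𝕜) * κ * τ) • vecMulVec v (star w)) =
      1 + ((c : 𝕜) - κ - c * κ * τ) • vecMulVec v (star w) := by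
    module
  rw [this, hs', zero_smul, add_zero]

theorem re_trace_inv_diagonal_add_smul_vecMulVec (d : n → ℝ) (hd : ∀ i, 0 < d i) (v : n → 𝕜)
    (c : ℝ) (h : 0 < 1 + c * ∑ i, ‖v i‖ ^ 2 / d i) :
    RCLike.re (trace (diagonal (fun i => (d i : 𝕜)) + (c : 𝕜) • vecMulVec v (star v))⁻¹) =
      ∑ i, (d i)⁻¹ - c * (∑ i, ‖v i‖ ^ 2 / d i ^ 2) / (1 + c * ∑ i, ‖v i‖ ^ 2 / d i) := by
  rw [inv_diagonal_add_smul_vecMulVec d hd v c h, trace_sub, trace_smul, trace_vecMulVec,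
    trace_diagonal]
  have h1 : (fun i => v i / (d i : 𝕜)) ⬝ᵥ (star fun i => v i / (d i : 𝕜)) =
      ((∑ i, ‖v i‖ ^ 2 / d i ^ 2 : ℝ) : 𝕜) := by
    simp only [dotProduct, Pi.star_apply, RCLike.star_def]
    push_cast
    refine Finset.sum_congr rfl fun i _ => ?_
    rw [RCLike.mul_conj]
    simp [div_pow, abs_of_pos (hd i)]
  rw [h1, smul_eq_mul, ← RCLike.ofReal_mul, map_sub, RCLike.ofReal_re, map_sum]
  congr 1
  · refine Finset.sum_congr rfl fun i _ => ?_
    rw [← RCLike.ofReal_inv, RCLike.ofReal_re]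
  · ring

/-- The matrix is positive definite and the trace of its inverse is at most `ε`. -/
def InvTraceLE (ε : ℝ) (A : Matrix n n 𝕜) : Prop :=
  A.PosDef ∧ RCLike.re (trace A⁻¹) ≤ ε

/-- Lets each barrier step be carried out in an eigenbasis, where both shifted matrices are
diagonal. -/
theorem invTraceLE_conj_iff {ε : ℝ} {A V : Matrix n n 𝕜} (hV : V ∈ unitaryGroup n 𝕜) :
    InvTraceLE ε (V * A * star V) ↔ InvTraceLE ε A := by
  have h1 : V * star V = 1 := mem_unitaryGroup_iff.1 hV
  have h2 : star V * V = 1 := mem_unitaryGroup_iff'.1 hV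
  have hu : IsUnit V := ⟨⟨V, star V, h1, h2⟩, rfl⟩
  have hi : V⁻¹ = star V := inv_eq_right_inv h1
  have hi' : (star V)⁻¹ = V := inv_eq_right_inv h2
  unfold InvTraceLE
  rw [IsUnit.posDef_star_right_conjugate_iff hu, Matrix.mul_inv_rev, Matrix.mul_inv_rev, hi, hi',
    ← mul_assoc, trace_mul_cycle, h2, one_mul]

theorem invTraceLE_diagonal_iff {ε : ℝ} {d : n → ℝ} :
    InvTraceLE ε (diagonal fun i => (d i : 𝕜)) ↔ (∀ i, 0 < d i) ∧ ∑ i, (d i)⁻¹ ≤ ε := by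
  unfold InvTraceLE
  rw [posDef_diagonal_iff]
  simp only [RCLike.ofReal_pos]
  refine and_congr_right fun hd => ?_
  have := re_trace_inv_diagonal_add_smul_vecMulVec (𝕜 := 𝕜) d hd 0 0 (by simp)
  simp only [RCLike.ofReal_zero, zero_smul, add_zero, zero_mul, zero_div, sub_zero] at this
  rw [this]

end SamplingDiscretization

namespace SamplingDiscretization

/-! ### The barrier argument for Parseval systems. -/

open Matrix
open scoped ComplexOrder

section ParsevalFrame

variable {𝕜 : Type*} [RCLike 𝕜] {n : Type*} [Fintype n] {Ω : Type*} [MeasurableSpace Ω]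

/-- The map `c ↦ ∑ i, c i * φ · i` is isometric into `L₂(μ)`. -/
def IsParseval (μ : Measure Ω) (φ : Ω → n → 𝕜) : Prop :=
  ∀ c : n → 𝕜, Integrable (fun x => ‖∑ i, c i * φ x i‖ ^ 2) μ ∧
    ∫ x, ‖∑ i, c i * φ x i‖ ^ 2 ∂μ = ∑ i, ‖c i‖ ^ 2

variable [DecidableEq n] {μ : Measure Ω} {φ : Ω → n → 𝕜}

theorem IsParseval.unitary (hφ : IsParseval μ φ) {V : Matrix n n 𝕜} (hV : V ∈ unitaryGroup n 𝕜)
    (i : n) : Integrable (fun x => ‖(star V *ᵥ φ x) i‖ ^ 2) μ ∧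
      ∫ x, ‖(star V *ᵥ φ x) i‖ ^ 2 ∂μ = 1 := by
  have h := hφ fun k => star V i k
  have h1 : ∑ k, ‖star V i k‖ ^ 2 = 1 := by
    have h2 : (star V * V) i i = 1 := by rw [mem_unitaryGroup_iff'.1 hV, one_apply_eq]
    have h3 : ((∑ k, ‖star V i k‖ ^ 2 : ℝ) : 𝕜) = 1 := by
      rw [← h2, mul_apply]
      push_cast
      refine Finset.sum_congr rfl fun k _ => ?_
      rw [← RCLike.conj_mul]
      simp [star_apply, mul_comm]
    exact_mod_cast h3
  rw [h1] at h
  exact h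

/-- By Sherman–Morrison, `t` suits the lower barrier if `1/t ≤ S/D - τ` and the upper one if `1/t ≥
S'/D' + τ'` and `1/t > τ'`. As each `‖v i‖ ^ 2` has mean 1, the two averaged estimates make this
interval nonempty at some point off `E`. -/
theorem exists_point_barrier [IsProbabilityMeasure μ] [Nonempty n] {E : Set Ω} (hE : μ E = 0)
    {v : Ω → n → 𝕜}
    (hv : ∀ i, Integrable (fun x => ‖v x i‖ ^ 2) μ ∧ ∫ x, ‖v x i‖ ^ 2 ∂μ = 1)
    {α β : n → ℝ} (hα : ∀ i, 0 < α i) (hα' : ∑ i, (α i)⁻¹ ≤ 1 / 2)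
    (hβ : ∀ i, 0 < β i) (hβ' : ∑ i, (β i)⁻¹ ≤ 1 / 6) :
    ∃ x ∉ E, ∃ t : ℝ, 0 < t ∧
      InvTraceLE (1 / 2)
        (diagonal (fun i => ((α i - 1 : ℝ) : 𝕜)) + (t : 𝕜) • vecMulVec (v x) (star (v x))) ∧
      InvTraceLE (1 / 6)
        (diagonal (fun i => ((β i + 4 : ℝ) : 𝕜)) + ((-t : ℝ) : 𝕜) • vecMulVec (v x) (star (v x))) := by
  obtain ⟨ha, hD, hlow⟩ := lower_barrier_average hα hα'
  obtain ⟨hD', hupp⟩ := upper_barrier_average hβ hβ'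
  have hb : ∀ i, 0 < β i + 4 := fun i => by linarith [hβ i]
  set D := ∑ i, (α i - 1)⁻¹ - ∑ i, (α i)⁻¹ with hDdef
  set D' := ∑ i, (β i)⁻¹ - ∑ i, (β i + 4)⁻¹ with hDdef'
  let w : n → ℝ := fun i => 1 / (α i - 1) ^ 2 / D - 1 / (α i - 1) -
    (1 / (β i + 4) ^ 2 / D' + 1 / (β i + 4))
  have hint : Integrable (fun x => ∑ i, w i * ‖v x i‖ ^ 2) μ :=
    integrable_finsetSum _ fun i _ => (hv i).1.const_mul _
  have hval : ∫ x, ∑ i, w i * ‖v x i‖ ^ 2 ∂μ = ∑ i, w i := by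
    rw [integral_finsetSum _ fun i _ => (hv i).1.const_mul _]
    refine Finset.sum_congr rfl fun i _ => ?_
    rw [integral_const_mul, (hv i).2, mul_one]
  have hw : 0 < ∑ i, w i := by
    simp only [w, Finset.sum_sub_distrib, Finset.sum_add_distrib, ← Finset.sum_div]
    linarith
  obtain ⟨x, hxE, hx⟩ := exists_notMem_null_integral_le hint hE
  rw [hval] at hx
  have hx := hw.trans_le hx
  set S := ∑ i, ‖v x i‖ ^ 2 / (α i - 1) ^ 2 with hS
  set τ := ∑ i, ‖v x i‖ ^ 2 / (α i - 1) with hτ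
  set S' := ∑ i, ‖v x i‖ ^ 2 / (β i + 4) ^ 2 with hS'
  set τ' := ∑ i, ‖v x i‖ ^ 2 / (β i + 4) with hτ'
  have hx2 : S' / D' + τ' < S / D - τ := by
    have : ∑ i, w i * ‖v x i‖ ^ 2 = S / D - τ - (S' / D' + τ') := by
      simp only [hS, hS', hτ, hτ', Finset.sum_div]
      rw [← Finset.sum_sub_distrib, ← Finset.sum_add_distrib, ← Finset.sum_sub_distrib]
      refine Finset.sum_congr rfl fun i _ => ?_
      simp only [w]
      ring
    linarith
  have hSnn : 0 ≤ S' := Finset.sum_nonneg fun i _ => by positivity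
  have hτnn : 0 ≤ τ := Finset.sum_nonneg fun i _ => div_nonneg (by positivity) (ha i).le
  have hτnn' : 0 ≤ τ' := Finset.sum_nonneg fun i _ => div_nonneg (by positivity) (hb i).le
  set L := S / D - τ with hL
  have hSD' : 0 ≤ S' / D' := div_nonneg hSnn hD'.le
  have hLpos : 0 < L := by linarith
  have hLτ' : 0 < L - τ' := by linarith
  -- The smallest `t` allowed by the lower barrier: the update lowers the lower potential by exactly
  -- `D`, undoing the shift.
  refine ⟨x, hxE, 1 / L, one_div_pos.2 hLpos, ?_, ?_⟩
  · have h1 : 0 < 1 + 1 / L * τ := by positivity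
    refine ⟨posDef_diagonal_add_smul_vecMulVec _ ha _ _ h1, ?_⟩
    rw [re_trace_inv_diagonal_add_smul_vecMulVec _ ha _ _ h1, ← hS, ← hτ]
    have h2 : 1 / L * S / (1 + 1 / L * τ) = D := by
      have h3 : L + τ = S / D := by rw [hL]; ring
      have h4 : 0 < S / D := by linarith
      have h5 : S ≠ 0 := by rintro h; simp [h] at h4
      have h6 : 1 / L * S / (1 + 1 / L * τ) = S / (L + τ) := by
        have : L + τ ≠ 0 := by positivity
        field_simp
      rw [h6, h3]
      field_simp
    rw [h2]
    linarith
  · have h1 : 0 < 1 + -(1 / L) * τ' := by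
      have : 1 + -(1 / L) * τ' = (L - τ') / L := by field_simp; ring
      rw [this]
      positivity
    refine ⟨posDef_diagonal_add_smul_vecMulVec _ hb _ _ h1, ?_⟩
    rw [re_trace_inv_diagonal_add_smul_vecMulVec _ hb _ _ h1, ← hS', ← hτ']
    have h2 : -(1 / L) * S' / (1 + -(1 / L) * τ') = - (S' / (L - τ')) := by
      have h3 : 1 + -(1 / L) * τ' = (L - τ') / L := by field_simp; ring
      rw [h3]
      field_simp
    have h4 : S' / (L - τ') ≤ D' := by
      rw [div_le_iff₀ hLτ', mul_comm, ← div_le_iff₀ hD']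
      linarith
    rw [h2]
    linarith

/-- One step of the Batson–Spielman–Srivastava barrier argument. -/
theorem exists_barrier_step [IsProbabilityMeasure μ] [Nonempty n] {E : Set Ω} (hE : μ E = 0)
    (hφ : IsParseval μ φ) {A : Matrix n n 𝕜} (hA : A.IsHermitian) {l u : ℝ}
    (hl : InvTraceLE (1 / 2) (A - (l : 𝕜) • 1)) (hu : InvTraceLE (1 / 6) ((u : 𝕜) • 1 - A)) :
    ∃ x ∉ E, ∃ t : ℝ, 0 < t ∧
      InvTraceLE (1 / 2)
        (A + (t : 𝕜) • vecMulVec (φ x) (star (φ x)) - ((l + 1 : ℝ) : 𝕜) • 1) ∧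
      InvTraceLE (1 / 6)
        (((u + 4 : ℝ) : 𝕜) • 1 - (A + (t : 𝕜) • vecMulVec (φ x) (star (φ x)))) := by
  set V : Matrix n n 𝕜 := (hA.eigenvectorUnitary : Matrix n n 𝕜) with hVdef
  have hV : V ∈ unitaryGroup n 𝕜 := hA.eigenvectorUnitary.2
  have h1 : V * star V = 1 := mem_unitaryGroup_iff.1 hV
  set e := hA.eigenvalues
  have hAV : A = V * diagonal (fun i => (e i : 𝕜)) * star V := hA.spectral_theorem
  have hsub (r : ℝ) : A - (r : 𝕜) • 1 = V * diagonal (fun i => ((e i - r : ℝ) : 𝕜)) * star V := by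
    have : diagonal (fun i => ((e i - r : ℝ) : 𝕜)) =
        diagonal (fun i => (e i : 𝕜)) - (r : 𝕜) • (1 : Matrix n n 𝕜) := by
      rw [smul_one_eq_diagonal, diagonal_sub]
      simp
    rw [this, mul_sub, sub_mul, ← hAV, Matrix.mul_smul, Matrix.smul_mul, mul_one, h1]
  have hsub' (r : ℝ) : (r : 𝕜) • 1 - A = V * diagonal (fun i => ((r - e i : ℝ) : 𝕜)) * star V := by
    rw [← neg_sub, hsub, ← neg_mul, ← mul_neg, diagonal_neg]
    congr 3
    ext i
    simp
  rw [hsub, invTraceLE_conj_iff hV, invTraceLE_diagonal_iff] at hl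
  rw [hsub', invTraceLE_conj_iff hV, invTraceLE_diagonal_iff] at hu
  obtain ⟨x, hxE, t, ht, hlow, hupp⟩ :=
    exists_point_barrier hE (fun i => hφ.unitary hV i) hl.1 hl.2 hu.1 hu.2
  have hrank : vecMulVec (φ x) (star (φ x)) =
      V * vecMulVec (star V *ᵥ φ x) (star (star V *ᵥ φ x)) * star V := by
    rw [mul_vecMulVec, vecMulVec_mul, mulVec_mulVec, h1, one_mulVec, star_mulVec, vecMul_vecMul,
      ← star_eq_conjTranspose, star_star, h1, vecMul_one]
  refine ⟨x, hxE, t, ht, ?_, ?_⟩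
  · rw [add_sub_right_comm, hsub, hrank, ← Matrix.smul_mul, ← Matrix.mul_smul, ← add_mul, ← mul_add,
      invTraceLE_conj_iff hV]
    simpa only [sub_sub] using hlow
  · rw [← sub_sub, hsub', hrank, ← Matrix.smul_mul, ← Matrix.mul_smul, ← sub_mul, ← mul_sub,
      invTraceLE_conj_iff hV]
    simpa only [sub_add_eq_add_sub, RCLike.ofReal_neg, neg_smul, ← sub_eq_add_neg] using hupp

theorem exists_barrier_sum [IsProbabilityMeasure μ] [Nonempty n] {E : Set Ω} (hE : μ E = 0)
    (hφ : IsParseval μ φ) (m : ℕ) :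
    ∃ (ξ : Fin m → Ω) (t : Fin m → ℝ), (∀ ν, ξ ν ∉ E) ∧ (∀ ν, 0 < t ν) ∧
      InvTraceLE (1 / 2) ((∑ ν, (t ν : 𝕜) • vecMulVec (φ (ξ ν)) (star (φ (ξ ν)))) -
        ((m - 2 * Fintype.card n : ℝ) : 𝕜) • 1) ∧
      InvTraceLE (1 / 6) (((4 * m + 6 * Fintype.card n : ℝ) : 𝕜) • 1 -
        ∑ ν, (t ν : 𝕜) • vecMulVec (φ (ξ ν)) (star (φ (ξ ν)))) := by
  induction m with
  | zero =>
    have hc : (0 : ℝ) < Fintype.card n := by exact_mod_cast Fintype.card_pos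
    -- For the zero matrix, barriers at `-2n` and `6n` give potentials exactly 1/2 and 1/6.
    refine ⟨Fin.elim0, Fin.elim0, fun ν => ν.elim0, fun ν => ν.elim0, ?_, ?_⟩
    · rw [Finset.univ_eq_empty, Finset.sum_empty, zero_sub, ← neg_smul, ← RCLike.ofReal_neg,
        smul_one_eq_diagonal, invTraceLE_diagonal_iff]
      refine ⟨fun _ => by simpa using hc, ?_⟩
      rw [Finset.sum_const, Finset.card_univ, nsmul_eq_mul]
      refine le_of_eq ?_
      push_cast
      field_simp
      ring
    · rw [Finset.univ_eq_empty, Finset.sum_empty, sub_zero,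
        smul_one_eq_diagonal, invTraceLE_diagonal_iff]
      refine ⟨fun _ => by simpa using hc, ?_⟩
      rw [Finset.sum_const, Finset.card_univ, nsmul_eq_mul]
      refine le_of_eq ?_
      push_cast
      field_simp
      ring
  | succ m ih =>
    obtain ⟨ξ, t, hξ, ht, hl, hu⟩ := ih
    have hA : (∑ ν, (t ν : 𝕜) • vecMulVec (φ (ξ ν)) (star (φ (ξ ν)))).IsHermitian := by
      refine (posSemidef_sum _ fun ν _ => ?_).isHermitian
      exact (posSemidef_vecMulVec_self_star _).smul (RCLike.ofReal_nonneg.2 (ht ν).le)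
    obtain ⟨x, hx, r, hr, hl', hu'⟩ := exists_barrier_step hE hφ hA hl hu
    refine ⟨Fin.snoc ξ x, Fin.snoc t r, ?_, ?_, ?_, ?_⟩
    · intro ν
      refine Fin.lastCases ?_ (fun i => ?_) ν <;> simp [hx, hξ]
    · intro ν
      refine Fin.lastCases ?_ (fun i => ?_) ν <;> simp [hr, ht]
    · rw [Fin.sum_univ_castSucc]
      simp only [Fin.snoc_castSucc, Fin.snoc_last]
      convert hl' using 4
      push_cast
      ring
    · rw [Fin.sum_univ_castSucc]
      simp only [Fin.snoc_castSucc, Fin.snoc_last]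
      convert hu' using 4
      push_cast
      ring

/-- A weighted discretization of a Parseval system in dimension `n` with any number `m ≥ 4 n` of
knots. -/
theorem IsParseval.exists_discretization [IsProbabilityMeasure μ] {E : Set Ω} (hE : μ E = 0)
    (hφ : IsParseval μ φ) {m : ℕ} (hm : 4 * Fintype.card n ≤ m) :
    ∃ (ξ : Fin m → Ω) (lam : Fin m → ℝ), (∀ ν, ξ ν ∉ E) ∧ (∀ ν, 0 < lam ν) ∧
      ∀ c : n → 𝕜, 1 / 2 * ∑ i, ‖c i‖ ^ 2 ≤ ∑ ν, lam ν * ‖∑ i, c i * φ (ξ ν) i‖ ^ 2 ∧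
        ∑ ν, lam ν * ‖∑ i, c i * φ (ξ ν) i‖ ^ 2 ≤ 6 * ∑ i, ‖c i‖ ^ 2 := by
  rcases isEmpty_or_nonempty n with hn | hn
  · obtain ⟨x, hx⟩ : ∃ x, x ∉ E := by
      by_contra! h
      have : E = Set.univ := Set.eq_univ_of_forall h
      simp [this] at hE
    exact ⟨fun _ => x, fun _ => 1, fun _ => hx, fun _ => one_pos, fun c => by simp⟩
  obtain ⟨ξ, t, hξ, ht, hl, hu⟩ := exists_barrier_sum hE hφ m
  have hc : (0 : ℝ) < Fintype.card n := by exact_mod_cast Fintype.card_pos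
  have hm' : (4 * Fintype.card n : ℝ) ≤ m := by exact_mod_cast hm
  have hmpos : (0 : ℝ) < m := by linarith
  refine ⟨ξ, fun ν => t ν / m, hξ, fun ν => div_pos (ht ν) hmpos, fun c => ?_⟩
  -- The form is evaluated at `star c` because the sums `∑ c i * φ i` carry no conjugation.
  have hform : star (star c) ⬝ᵥ
      ((∑ ν, (t ν : 𝕜) • vecMulVec (φ (ξ ν)) (star (φ (ξ ν)))) *ᵥ star c) =
      ((∑ ν, t ν * ‖∑ i, c i * φ (ξ ν) i‖ ^ 2 : ℝ) : 𝕜) := by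
    rw [sum_mulVec, dotProduct_sum]
    push_cast
    refine Finset.sum_congr rfl fun ν _ => ?_
    rw [smul_mulVec, vecMulVec_mulVec, dotProduct_smul, dotProduct_smul, star_star,
      star_dotProduct_star]
    have : ∑ i, c i * φ (ξ ν) i = c ⬝ᵥ φ (ξ ν) := rfl
    rw [this, ← RCLike.mul_conj]
    simp
  have hone (r : ℝ) : star (star c) ⬝ᵥ (((r : 𝕜) • (1 : Matrix n n 𝕜)) *ᵥ star c) =
      ((r * ∑ i, ‖c i‖ ^ 2 : ℝ) : 𝕜) := by
    rw [smul_mulVec, one_mulVec, dotProduct_smul, star_star, smul_eq_mul]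
    push_cast
    congr 1
    refine Finset.sum_congr rfl fun i _ => ?_
    rw [← RCLike.mul_conj]
    rfl
  have hl2 := hl.1.posSemidef.dotProduct_mulVec_nonneg (star c)
  have hu2 := hu.1.posSemidef.dotProduct_mulVec_nonneg (star c)
  rw [sub_mulVec, dotProduct_sub, hform, hone, ← RCLike.ofReal_sub, RCLike.ofReal_nonneg] at hl2
  rw [sub_mulVec, dotProduct_sub, hform, hone, ← RCLike.ofReal_sub, RCLike.ofReal_nonneg] at hu2
  have hsum : ∑ ν, t ν / m * ‖∑ i, c i * φ (ξ ν) i‖ ^ 2 =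
      (∑ ν, t ν * ‖∑ i, c i * φ (ξ ν) i‖ ^ 2) / m := by
    rw [Finset.sum_div]
    exact Finset.sum_congr rfl fun ν _ => by ring
  have hq : 0 ≤ ∑ i, ‖c i‖ ^ 2 := Finset.sum_nonneg fun i _ => by positivity
  rw [hsum, le_div_iff₀ hmpos, div_le_iff₀ hmpos]
  constructor <;> nlinarith [mul_le_mul_of_nonneg_right hm' hq]

end ParsevalFrame

end SamplingDiscretization

namespace SamplingDiscretization

/-! ### From Parseval systems to arbitrary finite families in L₂. -/

section Frames

variable {𝕜 : Type*} [RCLike 𝕜] {Ω : Type*} [MeasurableSpace Ω] {μ : Measure Ω}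

theorem lpNorm_rpow_two_mul_eq_integral {f : Ω → 𝕜} {s : ℕ} (hs : 1 ≤ s)
    (hf : AEStronglyMeasurable f μ) :
    lpNorm f (ENNReal.ofReal (2 * (s : ℝ))) μ ^ (2 * (s : ℝ)) = ∫ x, ‖f x ^ s‖ ^ 2 ∂μ := by
  have h2s : (0 : ℝ) < 2 * s := mul_pos two_pos (by exact_mod_cast hs)
  rw [lpNorm_eq_integral_norm_rpow_toReal (by simp; omega) ENNReal.ofReal_ne_top hf,
    ENNReal.toReal_ofReal h2s.le, Real.rpow_inv_rpow _ h2s.ne']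
  · refine integral_congr_ae (.of_forall fun x => ?_)
    simp only
    rw [norm_pow, ← pow_mul, mul_comm s 2, ← Real.rpow_natCast]
    push_cast
    rfl
  · exact integral_nonneg fun x => by positivity

theorem norm_sq_eq_integral (f : Lp 𝕜 2 μ) : ‖f‖ ^ 2 = ∫ x, ‖f x‖ ^ 2 ∂μ := by
  have h := lpNorm_rpow_two_mul_eq_integral (s := 1) le_rfl (Lp.aestronglyMeasurable f)
  norm_num at h
  rw [Lp.norm_def, toReal_eLpNorm (Lp.aestronglyMeasurable f), h]

theorem isParseval_of_orthonormal {n : Type*} [Fintype n] {b : n → Lp 𝕜 2 μ}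
    (hb : Orthonormal 𝕜 b) : IsParseval μ fun x i => b i x := by
  intro c
  set f : Lp 𝕜 2 μ := ∑ i, c i • b i with hf
  have hae : (fun x => ‖f x‖ ^ 2) =ᵐ[μ] fun x => ‖∑ i, c i * b i x‖ ^ 2 := by
    have h1 := Lp.coeFn_finsetSum Finset.univ fun i => c i • b i
    have h2 : ∀ᵐ x ∂μ, ∀ i, (c i • b i : Lp 𝕜 2 μ) x = c i * b i x :=
      ae_all_iff.2 fun i => Lp.coeFn_smul (c i) (b i)
    filter_upwards [h1, h2] with x hx1 hx2
    rw [hf, hx1, Finset.sum_apply]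
    simp only [hx2]
  refine ⟨((memLp_two_iff_integrable_sq_norm (Lp.aestronglyMeasurable f)).1
    (Lp.memLp f)).congr hae, ?_⟩
  rw [← integral_congr_ae hae, ← norm_sq_eq_integral, hf]
  have h := hb.inner_sum c c Finset.univ
  rw [inner_self_eq_norm_sq_to_K] at h
  simp only [RCLike.conj_mul] at h
  exact_mod_cast h

/-- An orthonormal basis of the span of the classes of the `g j`. The family may be dependent, and
the expansion holds only almost everywhere. -/
theorem exists_isParseval {ι : Type*} [Fintype ι] {g : ι → Ω → 𝕜} (hg : ∀ j, MemLp (g j) 2 μ) :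
    ∃ (n : ℕ) (φ : Ω → Fin n → 𝕜) (C : ι → Fin n → 𝕜), n ≤ Fintype.card ι ∧ IsParseval μ φ ∧
      ∀ᵐ x ∂μ, ∀ j, g j x = ∑ i, C j i * φ x i := by
  let G : ι → Lp 𝕜 2 μ := fun j => (hg j).toLp (g j)
  let W : Submodule 𝕜 (Lp 𝕜 2 μ) := Submodule.span 𝕜 (Set.range G)
  have : FiniteDimensional 𝕜 W := FiniteDimensional.span_of_finite 𝕜 (Set.finite_range G)
  let b := stdOrthonormalBasis 𝕜 W
  have hG : ∀ j, G j ∈ W := fun j => Submodule.subset_span ⟨j, rfl⟩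
  refine ⟨_, fun x i => (b i : Lp 𝕜 2 μ) x, fun j i => b.repr ⟨G j, hG j⟩ i, finrank_range_le_card G,
    isParseval_of_orthonormal (b.orthonormal.comp_linearIsometry W.subtypeₗᵢ), ?_⟩
  refine ae_all_iff.2 fun j => ?_
  have hsum : G j = ∑ i, b.repr ⟨G j, hG j⟩ i • (b i : Lp 𝕜 2 μ) := by
    have := congrArg (Subtype.val) (b.sum_repr ⟨G j, hG j⟩)
    simpa using this.symm
  have h1 := Lp.coeFn_finsetSum Finset.univ fun i => b.repr ⟨G j, hG j⟩ i • (b i : Lp 𝕜 2 μ)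
  rw [← hsum] at h1
  have h2 : ∀ᵐ x ∂μ, ∀ i, (b.repr ⟨G j, hG j⟩ i • (b i : Lp 𝕜 2 μ) : Lp 𝕜 2 μ) x =
      b.repr ⟨G j, hG j⟩ i * (b i : Lp 𝕜 2 μ) x :=
    ae_all_iff.2 fun i => Lp.coeFn_smul _ _
  filter_upwards [h1, h2, (hg j).coeFn_toLp] with x hx1 hx2 hx3
  rw [← hx3, show (hg j).toLp (g j) = G j from rfl, hx1, Finset.sum_apply]
  simp only [hx2]

/-- Weighted discretization of the `L₂` norm on the span of finitely many functions. -/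
theorem exists_discretization_of_memLp_two [IsProbabilityMeasure μ] {E : Set Ω} (hE : μ E = 0)
    {ι : Type*} [Fintype ι] {g : ι → Ω → 𝕜} (hg : ∀ j, MemLp (g j) 2 μ) {m : ℕ}
    (hm : 4 * Fintype.card ι ≤ m) :
    ∃ (ξ : Fin m → Ω) (lam : Fin m → ℝ), (∀ ν, ξ ν ∉ E) ∧ (∀ ν, 0 < lam ν) ∧
      ∀ a : ι → 𝕜,
        1 / 2 * ∫ x, ‖∑ j, a j * g j x‖ ^ 2 ∂μ ≤ ∑ ν, lam ν * ‖∑ j, a j * g j (ξ ν)‖ ^ 2 ∧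
        ∑ ν, lam ν * ‖∑ j, a j * g j (ξ ν)‖ ^ 2 ≤ 6 * ∫ x, ‖∑ j, a j * g j x‖ ^ 2 ∂μ := by
  obtain ⟨n, φ, C, hn, hφ, hae⟩ := exists_isParseval hg
  -- Knots must also avoid the null set where the expansion fails, so that it holds pointwise at
  -- each of them.
  have hE' : μ (E ∪ {x | ¬ ∀ j, g j x = ∑ i, C j i * φ x i}) = 0 :=
    measure_union_null hE (ae_iff.1 hae)
  obtain ⟨ξ, lam, hξ, hlam, h⟩ :=
    hφ.exists_discretization hE' (m := m) (by rw [Fintype.card_fin]; omega)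
  refine ⟨ξ, lam, fun ν hν => hξ ν (Or.inl hν), hlam, fun a => ?_⟩
  have hcomb {x : Ω} (hx : ∀ j, g j x = ∑ i, C j i * φ x i) :
      ∑ j, a j * g j x = ∑ i, (∑ j, a j * C j i) * φ x i := by
    simp only [hx, Finset.mul_sum, Finset.sum_mul, mul_assoc]
    exact Finset.sum_comm
  have hint : ∫ x, ‖∑ j, a j * g j x‖ ^ 2 ∂μ = ∑ i, ‖∑ j, a j * C j i‖ ^ 2 := by
    rw [← (hφ _).2]
    refine integral_congr_ae ?_
    filter_upwards [hae] with x hx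
    rw [hcomb hx]
  have hknot ν : ∑ j, a j * g j (ξ ν) = ∑ i, (∑ j, a j * C j i) * φ (ξ ν) i :=
    hcomb (not_not.1 fun hx => hξ ν (Or.inr hx))
  simp only [hint, hknot]
  exact h _

/-- Hölder with `s` exponents `2s`: the reciprocals add up to 1/2. -/
theorem memLp_two_prod {s : ℕ} (hs : 1 ≤ s) {u : Fin s → Ω → 𝕜}
    (hu : ∀ i, MemLp (u i) (ENNReal.ofReal (2 * (s : ℝ))) μ) :
    MemLp (fun x => ∏ i, u i x) 2 μ := by
  have h := MemLp.prod' (s := Finset.univ) fun i _ => hu i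
  convert h using 1
  have hs' : (s : ENNReal) ≠ 0 := by exact_mod_cast (by omega : s ≠ 0)
  rw [Finset.sum_const, Finset.card_univ, Fintype.card_fin, nsmul_eq_mul,
    ENNReal.ofReal_mul (by norm_num), ENNReal.ofReal_natCast,
    ENNReal.mul_inv (b := (s : ENNReal)) (Or.inr (ENNReal.natCast_ne_top s)) (Or.inr hs'),
    mul_left_comm, ENNReal.mul_inv_cancel hs' (ENNReal.natCast_ne_top s)]
  simp

end Frames

end SamplingDiscretization

/-! ### Reduction of the exponent `2s` to 2 by taking powers. -/

theorem mainTheorem7 :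
    ∃ C₁ C₂ C₃ : ℝ, 0 < C₁ ∧ C₁ ≤ C₂ ∧ 0 < C₃ ∧
      ∀ (s : ℕ), 1 ≤ s →
      ∀ (𝕜 : Type*) [RCLike 𝕜] (Ω : Type*) [MeasurableSpace Ω]
        (μ : MeasureTheory.Measure Ω) [MeasureTheory.IsProbabilityMeasure μ]
        (E : Set Ω), μ E = 0 →
      ∀ (N : ℕ) (X : Submodule 𝕜 (Ω → 𝕜)),
        SamplingDiscretization.IsSubspaceLq μ (2 * (s : ℝ)) N X →
      ∀ (m : ℕ), C₃ * (N : ℝ) ^ s ≤ (m : ℝ) →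
        SamplingDiscretization.WeightedMarcinkiewicz μ E X m (2 * (s : ℝ)) C₁ C₂ ∧
        SamplingDiscretization.PositiveWeightedMarcinkiewicz μ E X m (2 * (s : ℝ)) C₁ C₂ := by
  refine ⟨1 / 2, 6, 4, by norm_num, by norm_num, by norm_num, ?_⟩
  intro s hs 𝕜 _ Ω _ μ _ E hE N X hX m hm
  refine (fun h => ⟨h.weighted, h⟩) ?_
  obtain ⟨hmem, u, rfl⟩ := hX
  have hg : ∀ p : Fin s → Fin N, MemLp (fun x => ∏ i, u (p i) x) 2 μ := fun p =>
    SamplingDiscretization.memLp_two_prod hs fun i => hmem _ (Submodule.subset_span ⟨p i, rfl⟩)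
  have hm' : 4 * Fintype.card (Fin s → Fin N) ≤ m := by
    rw [Fintype.card_fun, Fintype.card_fin, Fintype.card_fin]
    exact_mod_cast hm
  obtain ⟨ξ, lam, hξ, hlam, h⟩ :=
    SamplingDiscretization.exists_discretization_of_memLp_two hE hg hm'
  refine ⟨ξ, lam, hξ, hlam, fun f hf => ?_⟩
  obtain ⟨c, hc⟩ := (Submodule.mem_span_range_iff_exists_fun 𝕜).1 hf
  have hpow : ∀ x, f x ^ s = ∑ p : Fin s → Fin N, (∏ i, c (p i)) * ∏ i, u (p i) x := by
    intro x
    have hx : f x = ∑ k, c k * u k x := by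
      rw [← hc]
      simp [Finset.sum_apply]
    rw [hx, Finset.sum_pow', Fintype.piFinset_univ]
    exact Finset.sum_congr rfl fun p _ => Finset.prod_mul_distrib
  have hrpow : ∀ x, ‖f x‖ ^ (2 * (s : ℝ)) = ‖f x ^ s‖ ^ 2 := by
    intro x
    rw [norm_pow, ← pow_mul, mul_comm s 2, ← Real.rpow_natCast]
    push_cast
    rfl
  rw [SamplingDiscretization.lpNorm_rpow_two_mul_eq_integral hs (hmem f hf).aestronglyMeasurable]
  simp only [hrpow, hpow]
  exact h _
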